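/- For $k\ge 0$ let $P_k$ be the path with $k$ edges. For graphs $T,G$ let $\mathcal N(T,G)$ be the number of (not necessarily induced) copies of $T$ in $G$, that is, of subgraphs of $G$ isomorphic to $T$, and let $\mathrm{ex}(n,T,F)$ be the maximum of $\mathcal N(T,G)$ over all graphs $G$ on $n$ vertices that contain no copy of $F$. For positive integers $a,b$ let $S^{(3)}_{a,b}$ be the graph on $a+b+3$ vertices consisting of a triangle with vertices $v,u,w$ and two independent sets $A,B$ with $|A|=a$, $|B|=b$, where in addition $v$ is joined to every vertex of $B$, and both $u$ and $w$ are joined to every vertex of $A$ (and there are no other edges). For $n\ge 5$ let $H_{n,6}$ be a graph with the maximum number of copies of $P_5$ among all the $n$-vertex graphs $S^{(3)}_{a,b}$ ($a,b\ge 1$, $a+b+3=n$). Theorem. There exist an integer $n_1\ge 5$ and a constant $C$ such that for every $n\ge n_1$ the graph $H_{n,6}$ (any such maximizer) contains no copy of $P_6$, $$\mathrm{ex}(n,P_5,P_6)=\mathcal N(P_5,H_{n,6}),$$ and $$\left|\mathrm{ex}(n,P_5,P_6)-\frac{8n^3}{27}\right|\le C\,n^2 .$$ -/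

import Mathlib

open Finset

/-- `pathEdges k` is the path `P_k` with `k` edges (hence `k + 1` vertices). -/
def pathEdges (k : ℕ) : SimpleGraph (Fin (k + 1)) := SimpleGraph.pathGraph (k + 1)

open scoped Classical in
/-- `exCopies n T F` is `ex(n, T, F)`: the maximum of the number of (not necessarily induced)
copies of `T`, that is, of subgraphs isomorphic to `T`, over all `F`-free graphs on `n` vertices. -/
noncomputable def exCopies (n : ℕ) {U W : Type} (T : SimpleGraph U) (F : SimpleGraph W) : ℕ :=
  ({G : SimpleGraph (Fin n) | F.Free G} : Finset (SimpleGraph (Fin n))).sup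
    fun G => G.copyCount T

/-- The graph `S^{(r)}_{a,b}`: a clique on `r` vertices (the summand `Fin r`) and two independent
sets `A` (the summand `Fin a`) and `B` (the summand `Fin b`). The vertex `v = 0` of the clique is
joined to every vertex of `B`, and every other vertex of the clique is joined to every vertex of
`A`. (`SimpleGraph.fromRel` makes the relation symmetric and removes the loops.) -/
def cliqueTwoSets (r a b : ℕ) : SimpleGraph (Fin r ⊕ (Fin a ⊕ Fin b)) :=
  SimpleGraph.fromRel fun x y =>
    match x, y with
    | .inl _, .inl _ => True
    | .inl i, .inr (.inl _) => i.val ≠ 0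
    | .inl i, .inr (.inr _) => i.val = 0
    | .inr _, _ => False

/-- `G` belongs to the family `𝒮^{(r)}_n` of the `n`-vertex graphs `S^{(r)}_{a,b}`, with `a` and
`b` positive (up to isomorphism). -/
def InFamilyS (r : ℕ) {n : ℕ} (G : SimpleGraph (Fin n)) : Prop :=
  ∃ a b : ℕ, 0 < a ∧ 0 < b ∧ Nonempty (G ≃g cliqueTwoSets r a b)

/-- `G` is a graph `H_{n,k}` (for `k` even): with `t = ⌊(k - 1) / 2⌋`, it belongs to the family
`𝒮^{(t+1)}_n` and has the maximum number of copies of `P_{k-1}` among the members of it. -/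
def IsGraphH (k : ℕ) {n : ℕ} (G : SimpleGraph (Fin n)) : Prop :=
  InFamilyS ((k - 1) / 2 + 1) G ∧
    ∀ G' : SimpleGraph (Fin n), InFamilyS ((k - 1) / 2 + 1) G' →
      G'.copyCount (pathEdges (k - 1)) ≤ G.copyCount (pathEdges (k - 1))

/-! Count ordered paths on six vertices, two per copy of `P₅`. In `S^{(3)}_{a,b}` the ordered paths
are exactly `a u a' w v b`, those with `u`, `w` exchanged, and the reversals, so there are `4 a (a -
1) b`, of order `16 n³ / 27` at best (`a ≈ 2n/3`).

For the upper bound, call two vertices with at least ten common neighbours a rich pair: a path can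
be routed through them while avoiding the few other vertices in play. Paths in which neither `x₂ x₄`
nor `x₃ x₅` is rich number `O(n²)` (`card_poorTuples_le`). In a path `x₁ u c w v b` with `u w` rich,
`c` determines the pair (`richPair_unique`), and the edges `v b` hanging from `w` number at most `n
+ 4 - deg u`. Without a broom, the edges hanging from `w` and those hanging from `u` cannot both be
numerous, so each `c` lies in the middle of at most about `n² / 4` such paths. This gives `n³ / 2 +
O(n²)` ordered paths in all, and `1/2 < 16/27`.

A broom forces its whole component into some `S^{(3)}_{a,b}` (`HasBroom.exists_isTwoSets`). Peeling
it off and inducting costs nothing, since `maxProd` is superadditive with a linear gain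
(`maxProd_superadditive`). The induction yields the bound up to a constant; for large `n`, the gain
of a single peeling absorbs that constant. -/

/-! ### Ordered paths and copies of `P₅` -/

/-- `x₁, …, x₆` are the successive vertices of a path of `G`. -/
def IsPathSix {V : Type*} (G : SimpleGraph V) (x₁ x₂ x₃ x₄ x₅ x₆ : V) : Prop :=
  G.Adj x₁ x₂ ∧ G.Adj x₂ x₃ ∧ G.Adj x₃ x₄ ∧ G.Adj x₄ x₅ ∧ G.Adj x₅ x₆ ∧
    [x₁, x₂, x₃, x₄, x₅, x₆].Nodup

/-- `G` has no path on seven vertices. -/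
def NoPathSeven {V : Type*} (G : SimpleGraph V) : Prop :=
  ∀ x₁ x₂ x₃ x₄ x₅ x₆ x₇ : V, G.Adj x₁ x₂ → G.Adj x₂ x₃ → G.Adj x₃ x₄ → G.Adj x₄ x₅ →
    G.Adj x₅ x₆ → G.Adj x₆ x₇ → ¬ [x₁, x₂, x₃, x₄, x₅, x₆, x₇].Nodup

open scoped Classical in
/-- The ordered paths on six vertices in `G`. -/
noncomputable def pathTuples {V : Type*} [Fintype V] (G : SimpleGraph V) :
    Finset (V × V × V × V × V × V) :=
  {p | IsPathSix G p.1 p.2.1 p.2.2.1 p.2.2.2.1 p.2.2.2.2.1 p.2.2.2.2.2}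

lemma mem_pathTuples {V : Type*} [Fintype V] {G : SimpleGraph V} {x₁ x₂ x₃ x₄ x₅ x₆ : V} :
    (x₁, x₂, x₃, x₄, x₅, x₆) ∈ pathTuples G ↔ IsPathSix G x₁ x₂ x₃ x₄ x₅ x₆ := by
  simp [pathTuples]

lemma IsPathSix.reverse {V : Type*} {G : SimpleGraph V} {x₁ x₂ x₃ x₄ x₅ x₆ : V}
    (h : IsPathSix G x₁ x₂ x₃ x₄ x₅ x₆) : IsPathSix G x₆ x₅ x₄ x₃ x₂ x₁ := by
  obtain ⟨h1, h2, h3, h4, h5, h6⟩ := h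
  exact ⟨h5.symm, h4.symm, h3.symm, h2.symm, h1.symm, List.nodup_reverse.mpr h6⟩

lemma noPathSeven_iff_free {V : Type*} {G : SimpleGraph V} :
    NoPathSeven G ↔ (pathEdges 6).Free G := by
  constructor
  · rintro h ⟨f⟩
    have hadj : ∀ i j : Fin 7, i.val + 1 = j.val → G.Adj (f i) (f j) := fun i j hij =>
      f.toHom.map_adj (by simp [pathEdges, SimpleGraph.pathGraph_adj, hij])
    refine h (f 0) (f 1) (f 2) (f 3) (f 4) (f 5) (f 6) (hadj _ _ rfl) (hadj _ _ rfl)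
      (hadj _ _ rfl) (hadj _ _ rfl) (hadj _ _ rfl) (hadj _ _ rfl) ?_
    have := (List.nodup_finRange 7).map f.injective
    simpa [List.finRange, List.ofFn_succ] using this
  · intro h x₁ x₂ x₃ x₄ x₅ x₆ x₇ h1 h2 h3 h4 h5 h6 hn
    refine h ⟨⟨![x₁, x₂, x₃, x₄, x₅, x₆, x₇], ?_⟩, ?_⟩
    · have key : ∀ i j : Fin 7, i.val + 1 = j.val →
          G.Adj (![x₁, x₂, x₃, x₄, x₅, x₆, x₇] i) (![x₁, x₂, x₃, x₄, x₅, x₆, x₇] j) := by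
        intro i j hij
        fin_cases i <;> fin_cases j <;> simp at hij <;> assumption
      intro i j hij
      rcases SimpleGraph.pathGraph_adj.mp hij with h | h
      · exact key _ _ h
      · exact (key _ _ h).symm
    · have : ![x₁, x₂, x₃, x₄, x₅, x₆, x₇] = fun i => [x₁, x₂, x₃, x₄, x₅, x₆, x₇].get i := by
        ext i; fin_cases i <;> rfl
      change Function.Injective ![x₁, x₂, x₃, x₄, x₅, x₆, x₇]
      rw [this]
      exact List.nodup_iff_injective_get.mp hn

/-- The path copy with the given vertices. -/
def IsPathSix.toCopy {V : Type*} {G : SimpleGraph V} {x₁ x₂ x₃ x₄ x₅ x₆ : V}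
    (h : IsPathSix G x₁ x₂ x₃ x₄ x₅ x₆) : SimpleGraph.Copy (pathEdges 5) G :=
  ⟨⟨![x₁, x₂, x₃, x₄, x₅, x₆], by
    obtain ⟨h1, h2, h3, h4, h5, -⟩ := h
    have key : ∀ i j : Fin 6, i.val + 1 = j.val →
        G.Adj (![x₁, x₂, x₃, x₄, x₅, x₆] i) (![x₁, x₂, x₃, x₄, x₅, x₆] j) := by
      intro i j hij
      fin_cases i <;> fin_cases j <;> simp at hij <;> assumption
    intro i j hij
    rcases SimpleGraph.pathGraph_adj.mp hij with h | h
    · exact key _ _ h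
    · exact (key _ _ h).symm⟩, by
    have : ![x₁, x₂, x₃, x₄, x₅, x₆] = fun i => [x₁, x₂, x₃, x₄, x₅, x₆].get i := by
      ext i; fin_cases i <;> rfl
    change Function.Injective ![x₁, x₂, x₃, x₄, x₅, x₆]
    rw [this]
    exact List.nodup_iff_injective_get.mp h.2.2.2.2.2⟩

lemma isPathSix_of_copy {V : Type*} {G : SimpleGraph V}
    (f : SimpleGraph.Copy (pathEdges 5) G) :
    IsPathSix G (f 0) (f 1) (f 2) (f 3) (f 4) (f 5) := by
  have hadj : ∀ i j : Fin 6, i.val + 1 = j.val → G.Adj (f i) (f j) := fun i j hij =>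
    f.toHom.map_adj (by simp [pathEdges, SimpleGraph.pathGraph_adj, hij])
  refine ⟨hadj _ _ rfl, hadj _ _ rfl, hadj _ _ rfl, hadj _ _ rfl, hadj _ _ rfl, ?_⟩
  have := (List.nodup_finRange 6).map f.injective
  simpa [List.finRange, List.ofFn_succ] using this

/-- Ordered paths on six vertices are the labelled copies of the path with five edges. -/
noncomputable def copyEquivPathTuples {V : Type*} [Fintype V] (G : SimpleGraph V) :
    SimpleGraph.Copy (pathEdges 5) G ≃ pathTuples G where
  toFun f := ⟨(f 0, f 1, f 2, f 3, f 4, f 5), mem_pathTuples.mpr (isPathSix_of_copy f)⟩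
  invFun p := (mem_pathTuples.mp p.2).toCopy
  left_inv f := by
    ext i
    change ![f 0, f 1, f 2, f 3, f 4, f 5] i = f i
    fin_cases i <;> rfl
  right_inv p := rfl

/-- Consecutive values differ by one and values two steps apart are distinct, so `p` never turns
back. -/
lemma pathGraph_six_endomorphism (p : Fin 6 → Fin 6) (hp : Function.Injective p)
    (hadj : ∀ i j, (pathEdges 5).Adj i j → (pathEdges 5).Adj (p i) (p j)) :
    p = id ∨ p = Fin.rev := by
  have h : ∀ i j : Fin 6, i.val + 1 = j.val →
      (p i).val + 1 = (p j).val ∨ (p j).val + 1 = (p i).val := fun i j hij =>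
    SimpleGraph.pathGraph_adj.mp (hadj i j (SimpleGraph.pathGraph_adj.mpr (Or.inl hij)))
  have h01 := h 0 1 rfl
  have h12 := h 1 2 rfl
  have h23 := h 2 3 rfl
  have h34 := h 3 4 rfl
  have h45 := h 4 5 rfl
  have hne : ∀ i j : Fin 6, i ≠ j → (p i).val ≠ (p j).val := fun i j hij e =>
    hij (hp (Fin.ext e))
  have n02 := hne 0 2 (by decide)
  have n13 := hne 1 3 (by decide)
  have n24 := hne 2 4 (by decide)
  have n35 := hne 3 5 (by decide)
  have b0 := (p 0).isLt
  have b5 := (p 5).isLt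
  have hcase : ((p 0).val = 0 ∧ (p 1).val = 1 ∧ (p 2).val = 2 ∧ (p 3).val = 3 ∧ (p 4).val = 4 ∧
      (p 5).val = 5) ∨ ((p 0).val = 5 ∧ (p 1).val = 4 ∧ (p 2).val = 3 ∧ (p 3).val = 2 ∧
      (p 4).val = 1 ∧ (p 5).val = 0) := by omega
  rcases hcase with ⟨h0, h1, h2, h3, h4, h5⟩ | ⟨h0, h1, h2, h3, h4, h5⟩
  · left; funext i; apply Fin.ext; fin_cases i <;> assumption
  · right; funext i; apply Fin.ext; fin_cases i <;> assumption

/-- Every path on six vertices has two orderings. -/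
lemma two_mul_copyCount_eq_card_pathTuples {V : Type*} [Fintype V] (G : SimpleGraph V) :
    2 * G.copyCount (pathEdges 5) = #(pathTuples G) := by
  classical
  have hcard : #(pathTuples G) = #(univ : Finset (SimpleGraph.Copy (pathEdges 5) G)) := by
    rw [card_univ, Fintype.card_congr (copyEquivPathTuples G), Fintype.card_coe]
  rw [hcard, SimpleGraph.copyCount_eq_card_image_copyToSubgraph,
    card_eq_sum_card_image SimpleGraph.Copy.toSubgraph, mul_comm]
  symm
  apply sum_const_nat
  intro S hS
  obtain ⟨f, -, rfl⟩ := mem_image.mp hS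
  let r : SimpleGraph.Copy (pathEdges 5) (pathEdges 5) :=
    ⟨⟨Fin.rev, fun {i j} hij => by
      have := SimpleGraph.pathGraph_adj.mp hij
      refine SimpleGraph.pathGraph_adj.mpr ?_
      simp only [Fin.val_rev]
      omega⟩, Fin.rev_injective⟩
  have hr : ∀ i, r i = Fin.rev i := fun _ => rfl
  -- Labelled copies with the same image differ by an automorphism of the path: the identity or the
  -- reversal `r`.
  have : ({g | g.toSubgraph = f.toSubgraph} : Finset (SimpleGraph.Copy (pathEdges 5) G)) =
      {f, f.comp r} := by
    ext g
    simp only [mem_filter, mem_univ, true_and, mem_insert, mem_singleton]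
    constructor
    · intro hg
      have hv : ∀ i, ∃ j, f j = g i := by
        intro i
        have : g i ∈ g.toSubgraph.verts := by simp [SimpleGraph.Copy.toSubgraph]
        rw [hg] at this
        simpa [SimpleGraph.Copy.toSubgraph] using this
      choose σ hσ using hv
      have hσi : Function.Injective σ := fun i j e => g.injective (by
        simp only [SimpleGraph.Copy.toHom_apply]
        rw [← hσ i, ← hσ j, e])
      have hσa : ∀ i j, (pathEdges 5).Adj i j → (pathEdges 5).Adj (σ i) (σ j) := by
        intro i j hij
        have : g.toSubgraph.Adj (g i) (g j) := by
          simp only [SimpleGraph.Subgraph.map_adj]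
          exact ⟨i, j, hij, rfl, rfl⟩
        rw [hg] at this
        obtain ⟨a, b, hab, ha, hb⟩ := this
        have ha' : a = σ i := f.injective (ha.trans (hσ i).symm)
        have hb' : b = σ j := f.injective (hb.trans (hσ j).symm)
        subst ha' hb'
        exact hab
      rcases pathGraph_six_endomorphism σ hσi hσa with h | h
      · left; ext i; rw [← hσ i, h]; rfl
      · right; ext i; rw [← hσ i, h]; rfl
    · rintro (rfl | rfl)
      · rfl
      · have : Function.Involutive r := fun i => Fin.rev_rev i
        ext x y
        · simp only [SimpleGraph.Subgraph.map_verts, SimpleGraph.Subgraph.verts_top,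
            Set.image_univ, Set.mem_range, SimpleGraph.Copy.toHom_apply,
            SimpleGraph.Copy.comp_apply]
          exact ⟨fun ⟨i, hi⟩ => ⟨r i, hi⟩, fun ⟨i, hi⟩ => ⟨r i, by rwa [this i]⟩⟩
        · constructor
          · rintro ⟨a, b, hab, ha, hb⟩
            exact ⟨r a, r b, r.toHom.map_adj hab, ha, hb⟩
          · rintro ⟨a, b, hab, ha, hb⟩
            refine ⟨r a, r b, r.toHom.map_adj hab, ?_, ?_⟩
            · exact (congrArg f (this a)).trans ha
            · exact (congrArg f (this b)).trans hb
  rw [this, card_pair]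
  intro h
  have h0 : (0 : Fin 6) = Fin.rev 0 := f.injective (DFunLike.congr_fun h 0)
  exact absurd h0 (by decide)

lemma card_pathTuples_le_of_copy {V W : Type*} [Fintype V] [Fintype W]
    {G : SimpleGraph V} {H : SimpleGraph W} (c : SimpleGraph.Copy G H) :
    #(pathTuples G) ≤ #(pathTuples H) := by
  classical
  rw [← Fintype.card_coe, ← Fintype.card_coe, ← Fintype.card_congr (copyEquivPathTuples G),
    ← Fintype.card_congr (copyEquivPathTuples H)]
  refine Fintype.card_le_of_injective (fun f => c.comp f) fun f g h => ?_
  ext i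
  exact c.injective (DFunLike.congr_fun h i)

lemma card_pathTuples_congr {V W : Type*} [Fintype V] [Fintype W]
    {G : SimpleGraph V} {H : SimpleGraph W} (e : G ≃g H) :
    #(pathTuples G) = #(pathTuples H) :=
  (card_pathTuples_le_of_copy e.toCopy).antisymm (card_pathTuples_le_of_copy e.symm.toCopy)

/-! ### Rich pairs and configurations forbidden by the absence of a seven-vertex path -/

/-- `u` and `w` are distinct vertices with at least ten common neighbours. -/
def RichPair {V : Type*} (G : SimpleGraph V) (u w : V) : Prop :=
  u ≠ w ∧ ∃ A : Finset V, 10 ≤ #A ∧ ∀ a ∈ A, G.Adj u a ∧ G.Adj w a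

lemma RichPair.symm {V : Type*} {G : SimpleGraph V} {u w : V} (h : RichPair G u w) :
    RichPair G w u :=
  ⟨h.1.symm, h.2.imp fun _ hA => ⟨hA.1, fun a ha => (hA.2 a ha).symm⟩⟩

/-- The tool for greedy routing through a rich pair. At most five vertices are ever listed in `L`,
so the threshold ten is generous. -/
lemma RichPair.exists_common {V : Type*} {G : SimpleGraph V} {u w : V} (h : RichPair G u w)
    (L : List V) (hL : L.length < 10) : ∃ a, G.Adj u a ∧ G.Adj w a ∧ a ∉ L := by
  classical
  obtain ⟨-, A, hA, hadj⟩ := h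
  obtain ⟨a, ha, haL⟩ := exists_mem_notMem_of_card_lt_card (s := L.toFinset) (t := A)
    (L.toFinset_card_le.trans_lt (hL.trans_le hA))
  exact ⟨a, (hadj a ha).1, (hadj a ha).2, fun h => haL (List.mem_toFinset.mpr h)⟩

section Forbidden

variable {V : Type*} {G : SimpleGraph V}

/-- Disjoint middle pairs combine into `x₁ x₂ x y x₅ y' x'`. -/
lemma middle_pairs_meet (hG : NoPathSeven G) {x₁ x₂ x y x₅ x₆ x' y' : V}
    (h : IsPathSix G x₁ x₂ x y x₅ x₆) (h' : IsPathSix G x₁ x₂ x' y' x₅ x₆) :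
    x = x' ∨ x = y' ∨ y = x' ∨ y = y' := by
  by_contra hne
  obtain ⟨h1, h2, h3, h4, h5, h6⟩ := h
  obtain ⟨h1', h2', h3', h4', h5', h6'⟩ := h'
  refine hG x₁ x₂ x y x₅ y' x' h1 h2 h3 h4 h4'.symm h3'.symm ?_
  simp only [List.nodup_cons, List.mem_cons, List.not_mem_nil, not_or] at *
  grind

/-- Two edges `v b` hanging from `w` (away from `u`) with the same end `b` coincide. -/
lemma hanging_determined (hG : NoPathSeven G) {u w v b v' : V} (hr : RichPair G u w)
    (hwv : G.Adj w v) (hvb : G.Adj v b) (hvu : v ≠ u) (hbu : b ≠ u) (hbw : b ≠ w)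
    (hwv' : G.Adj w v') (hvb' : G.Adj v' b) (hvu' : v' ≠ u) : v = v' := by
  by_contra hne
  obtain ⟨a, hua, hwa, ha⟩ := hr.exists_common [v, b, v'] (by simp)
  obtain ⟨c, huc, hwc, hc⟩ := hr.exists_common [v, b, v', a] (by simp)
  refine hG v b v' w a u c hvb hvb'.symm hwv'.symm hwa hua.symm huc ?_
  have := hr.1
  simp only [List.nodup_cons, List.mem_cons, List.not_mem_nil, not_or] at *
  grind [G.ne_of_adj]

/-- A hanging edge `v b` closes when `b` is also adjacent to `u`. Two closing edges at `v` would
give the path `b v b' u a w c`. -/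
lemma closing_determined (hG : NoPathSeven G) {u w v b b' : V} (hr : RichPair G u w)
    (hwv : G.Adj w v) (hvb : G.Adj v b) (hvu : v ≠ u) (hbw : b ≠ w)
    (hvb' : G.Adj v b') (hbw' : b' ≠ w) (hub : G.Adj u b) (hub' : G.Adj u b') : b = b' := by
  by_contra hne
  obtain ⟨a, hua, hwa, ha⟩ := hr.exists_common [v, b, b'] (by simp)
  obtain ⟨c, huc, hwc, hc⟩ := hr.exists_common [v, b, b', a] (by simp)
  refine hG b v b' u a w c hvb.symm hvb' hub'.symm hua hwa.symm hwc ?_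
  have := hr.1
  simp only [List.nodup_cons, List.mem_cons, List.not_mem_nil, not_or] at *
  grind [G.ne_of_adj]

lemma closing_pairs_meet (hG : NoPathSeven G) {u w v b v' b' : V} (hr : RichPair G u w)
    (hwv : G.Adj w v) (hvb : G.Adj v b) (hvu : v ≠ u) (hbw : b ≠ w)
    (hwv' : G.Adj w v') (hvb' : G.Adj v' b') (hvu' : v' ≠ u) (hbw' : b' ≠ w)
    (hub : G.Adj u b) (hub' : G.Adj u b') : v = v' ∨ v = b' ∨ b = v' ∨ b = b' := by
  by_contra hne
  obtain ⟨a, hua, hwa, ha⟩ := hr.exists_common [v, b, v', b'] (by simp)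
  refine hG b' v' w v b u a hvb'.symm hwv'.symm hwv hvb hub.symm hua ?_
  have := hr.1
  simp only [List.nodup_cons, List.mem_cons, List.not_mem_nil, not_or] at *
  grind [G.ne_of_adj]

/-- Hanging edges at the two vertices of a rich pair have the same inner vertex. -/
lemma open_hanging_inner_eq (hG : NoPathSeven G) {u w v b v' b' : V} (hr : RichPair G u w)
    (hwv : G.Adj w v) (hvb : G.Adj v b) (hvu : v ≠ u) (hbu : b ≠ u) (hbw : b ≠ w)
    (hub : ¬ G.Adj u b) (huv' : G.Adj u v') (hvb' : G.Adj v' b') (hvw' : v' ≠ w)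
    (hbu' : b' ≠ u) (hbw' : b' ≠ w) (hwb' : ¬ G.Adj w b') : v = v' := by
  by_contra hne
  obtain ⟨a, hua, hwa, ha⟩ := hr.exists_common [v, b, v', b'] (by simp)
  obtain ⟨c, huc, hwc, hc⟩ := hr.exists_common [v, b, v', b', a] (by simp)
  have := hr.1
  by_cases hbb : b = b'
  · subst hbb
    refine hG a u v' b v w c hua.symm huv' hvb' hvb.symm hwv.symm hwc ?_
    simp only [List.nodup_cons, List.mem_cons, List.not_mem_nil, not_or] at *
    grind [G.ne_of_adj]
  · refine hG b v w a u v' b' hvb.symm hwv.symm hwa hua.symm huv' hvb' ?_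
    simp only [List.nodup_cons, List.mem_cons, List.not_mem_nil, not_or] at *
    grind [G.ne_of_adj]

lemma no_two_rich (hG : NoPathSeven G) {u w w' : V} (hr : RichPair G u w)
    (hr' : RichPair G u w') (hne : w ≠ w') : False := by
  obtain ⟨a, hua, hwa, ha⟩ := hr.exists_common [w'] (by simp)
  obtain ⟨c, huc, hwc, hc⟩ := hr.exists_common [w', a] (by simp)
  obtain ⟨a', hua', hwa', ha'⟩ := hr'.exists_common [w, a, c] (by simp)
  obtain ⟨c', huc', hwc', hc'⟩ := hr'.exists_common [w, a, c, a'] (by simp)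
  refine hG a w c u a' w' c' hwa.symm hwc huc.symm hua' hwa'.symm hwc' ?_
  have := hr.1
  have := hr'.1
  simp only [List.nodup_cons, List.mem_cons, List.not_mem_nil, not_or] at *
  grind [G.ne_of_adj]

/-- Rich pairs sharing one vertex are excluded by `no_two_rich`; disjoint ones with the common
neighbour `c` give `a u d w c u' z`. Hence the rich paths can be counted by their third vertex. -/
lemma richPair_unique (hG : NoPathSeven G) {u w u' w' c : V} (hr : RichPair G u w)
    (hr' : RichPair G u' w') (huc : G.Adj u c) (hwc : G.Adj w c) (huc' : G.Adj u' c)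
    (hwc' : G.Adj w' c) : (u = u' ∧ w = w') ∨ (u = w' ∧ w = u') := by
  by_contra hne
  have n1 : u ≠ u' := by
    rintro rfl; exact no_two_rich hG hr hr' (by grind)
  have n2 : u ≠ w' := by
    rintro rfl; exact no_two_rich hG hr hr'.symm (by grind)
  have n3 : w ≠ u' := by
    rintro rfl; exact no_two_rich hG hr.symm hr' (by grind)
  have n4 : w ≠ w' := by
    rintro rfl; exact no_two_rich hG hr.symm hr'.symm (by grind)
  obtain ⟨a, hua, hwa, ha⟩ := hr.exists_common [c, u', w'] (by simp)
  obtain ⟨d, hud, hwd, hd⟩ := hr.exists_common [c, u', w', a] (by simp)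
  obtain ⟨z, huz, hwz, hz⟩ := hr'.exists_common [c, u, w, a, d] (by simp)
  refine hG a u d w c u' z hua.symm hud hwd.symm hwc huc'.symm huz ?_
  have := hr.1
  have := hr'.1
  simp only [List.nodup_cons, List.mem_cons, List.not_mem_nil, not_or] at *
  grind [G.ne_of_adj]

/-- The end of a path on six vertices has all its neighbours on that path. -/
lemma adj_end_mem (hG : NoPathSeven G) {x₁ x₂ x₃ x₄ x₅ x₆ y : V}
    (h : IsPathSix G x₁ x₂ x₃ x₄ x₅ x₆) (hy : G.Adj x₁ y) : y ∈ [x₂, x₃, x₄, x₅, x₆] := by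
  by_contra hne
  obtain ⟨h1, h2, h3, h4, h5, h6⟩ := h
  refine hG y x₁ x₂ x₃ x₄ x₅ x₆ hy.symm h1 h2 h3 h4 h5 (List.nodup_cons.mpr ⟨?_, h6⟩)
  rw [List.mem_cons, not_or]
  exact ⟨hy.ne', hne⟩

end Forbidden

/-! ### Counting paths without a broom -/

section Counting

open scoped Classical in
/-- A set of pairs, any two of which meet, in which every vertex is the first (and the second)
coordinate of at most `k` pairs, is small. -/
lemma card_le_of_pairs_meet {V : Type*} {E : Finset (V × V)} {k : ℕ}
    (hE : ∀ x y x' y', (x, y) ∈ E → (x', y') ∈ E → x = x' ∨ x = y' ∨ y = x' ∨ y = y')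
    (h₁ : ∀ z, #{p ∈ E | p.1 = z} ≤ k) (h₂ : ∀ z, #{p ∈ E | p.2 = z} ≤ k) : #E ≤ 4 * k := by
  rcases E.eq_empty_or_nonempty with rfl | ⟨⟨x, y⟩, hxy⟩
  · simp
  -- Every pair has a coordinate equal to `x` or `y`, which leaves four classes of size at most `k`.
  have hsub : E ⊆ ({p ∈ E | p.1 = x} ∪ {p ∈ E | p.2 = y}) ∪
      ({p ∈ E | p.1 = y} ∪ {p ∈ E | p.2 = x}) := by
    rintro ⟨x', y'⟩ h'
    have := hE x y x' y' hxy h'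
    simp only [mem_union, mem_filter]
    grind
  have h3 := (card_le_card hsub).trans (card_union_le _ _)
  have h4 := card_union_le {p ∈ E | p.1 = x} {p ∈ E | p.2 = y}
  have h5 := card_union_le {p ∈ E | p.1 = y} {p ∈ E | p.2 = x}
  have := h₁ x; have := h₁ y; have := h₂ x; have := h₂ y
  omega

lemma card_lt_of_not_richPair {V : Type*} {G : SimpleGraph V} {u w : V} (hne : u ≠ w) (h : ¬ RichPair G u w) (A : Finset V)
    (hA : ∀ a ∈ A, G.Adj u a ∧ G.Adj w a) : #A ≤ 9 := by
  by_contra hc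
  exact h ⟨hne, A, by omega, hA⟩

variable {V : Type*} [Fintype V] {G : SimpleGraph V}

open scoped Classical in
/-- The vertices adjacent to `x`. -/
noncomputable def nbrs (G : SimpleGraph V) (x : V) : Finset V := {y | G.Adj x y}

@[simp] lemma mem_nbrs {x y : V} : y ∈ nbrs G x ↔ G.Adj x y := by simp [nbrs]

lemma card_nbrs_end_le (hG : NoPathSeven G) {x₁ x₂ x₃ x₄ x₅ x₆ : V}
    (h : IsPathSix G x₁ x₂ x₃ x₄ x₅ x₆) : #(nbrs G x₁) ≤ 5 := by
  classical
  refine (card_le_card (t := [x₂, x₃, x₄, x₅, x₆].toFinset) fun y hy => ?_).trans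
    (List.toFinset_card_le _)
  exact List.mem_toFinset.mpr (adj_end_mem hG h (mem_nbrs.mp hy))

open scoped Classical in
/-- Ordered paths in which neither pair of inner vertices at distance two is rich. -/
noncomputable def poorTuples (G : SimpleGraph V) : Finset (V × V × V × V × V × V) :=
  {p ∈ pathTuples G | ¬ RichPair G p.2.1 p.2.2.2.1 ∧ ¬ RichPair G p.2.2.1 p.2.2.2.2.1}

open scoped Classical in
/-- Ordered paths whose second and fourth vertices form a rich pair. -/
noncomputable def richTuples (G : SimpleGraph V) : Finset (V × V × V × V × V × V) :=
  {p ∈ pathTuples G | RichPair G p.2.1 p.2.2.2.1}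

open scoped Classical in
lemma card_middle_pairs_le (hG : NoPathSeven G) (x₁ x₂ x₅ x₆ : V) :
    #{q : V × V | (x₁, x₂, q.1, q.2, x₅, x₆) ∈ poorTuples G} ≤ 36 := by
  refine card_le_of_pairs_meet (k := 9) ?_ ?_ ?_
  · intro x y x' y' h h'
    simp only [poorTuples, mem_filter, mem_univ, true_and, mem_pathTuples] at h h'
    exact middle_pairs_meet hG h.1 h'.1
  -- With `x₃ = z` fixed, `x₄` is a common neighbour of `z` and `x₅`, which are not a rich pair: at
  -- most nine choices. The other coordinate is symmetric, with `x₂` and `x₄`.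
  · intro z
    rcases ({p ∈ ({q : V × V | (x₁, x₂, q.1, q.2, x₅, x₆) ∈ poorTuples G} : Finset _) |
      p.1 = z}).eq_empty_or_nonempty with h0 | ⟨⟨z', y⟩, h0⟩
    · rw [h0]; simp
    simp only [poorTuples, mem_filter, mem_univ, true_and, mem_pathTuples] at h0
    obtain ⟨⟨hp, -, hr⟩, rfl⟩ := h0
    rw [← card_image_of_injOn (f := Prod.snd)]
    · refine card_lt_of_not_richPair ?_ hr _ ?_
      · have := hp.2.2.2.2.2
        simp only [List.nodup_cons, List.mem_cons, not_or] at this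
        tauto
      · intro a ha
        simp only [poorTuples, mem_image, mem_filter, mem_univ, true_and, mem_pathTuples,
          Prod.exists] at ha
        obtain ⟨c, d, ⟨⟨hp', -⟩, rfl⟩, rfl⟩ := ha
        exact ⟨hp'.2.2.1, hp'.2.2.2.1.symm⟩
    · rintro ⟨a, b⟩ h1 ⟨c, d⟩ h2 h3
      simp only [coe_filter, Set.mem_ofPred_eq] at h1 h2
      ext
      · exact h1.2.trans h2.2.symm
      · exact h3
  · intro z
    rcases ({p ∈ ({q : V × V | (x₁, x₂, q.1, q.2, x₅, x₆) ∈ poorTuples G} : Finset _) |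
      p.2 = z}).eq_empty_or_nonempty with h0 | ⟨⟨y, z'⟩, h0⟩
    · rw [h0]; simp
    simp only [poorTuples, mem_filter, mem_univ, true_and, mem_pathTuples] at h0
    obtain ⟨⟨hp, hr, -⟩, rfl⟩ := h0
    rw [← card_image_of_injOn (f := Prod.fst)]
    · refine card_lt_of_not_richPair ?_ hr _ ?_
      · have := hp.2.2.2.2.2
        simp only [List.nodup_cons, List.mem_cons, not_or] at this
        tauto
      · intro a ha
        simp only [poorTuples, mem_image, mem_filter, mem_univ, true_and, mem_pathTuples,
          Prod.exists] at ha
        obtain ⟨c, d, ⟨⟨hp', -⟩, rfl⟩, rfl⟩ := ha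
        exact ⟨hp'.2.1, hp'.2.2.1.symm⟩
    · rintro ⟨a, b⟩ h1 ⟨c, d⟩ h2 h3
      simp only [coe_filter, Set.mem_ofPred_eq] at h1 h2
      ext
      · exact h3
      · exact h1.2.trans h2.2.symm

/-- `900 = 36 · 25`: at most 36 middle pairs once the other four vertices are fixed, and at most
five neighbours for each of the two ends. -/
lemma card_poorTuples_le (hG : NoPathSeven G) :
    #(poorTuples G) ≤ 900 * Fintype.card V ^ 2 := by
  classical
  have step₁ : #(poorTuples G) ≤
      36 * #((poorTuples G).image fun p => (p.1, p.2.1, p.2.2.2.2.1, p.2.2.2.2.2)) := by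
    refine card_le_mul_card_image _ _ ?_
    rintro ⟨x₁, x₂, x₅, x₆⟩ -
    refine le_trans ?_ (card_middle_pairs_le hG x₁ x₂ x₅ x₆)
    refine card_le_card_of_injOn (fun p => (p.2.2.1, p.2.2.2.1)) ?_ ?_
    · rintro ⟨y₁, y₂, y₃, y₄, y₅, y₆⟩ h
      simp only [coe_filter, Set.mem_ofPred_eq, Prod.mk.injEq] at h
      obtain ⟨h, rfl, rfl, rfl, rfl⟩ := h
      simpa using h
    · rintro ⟨y₁, y₂, y₃, y₄, y₅, y₆⟩ h ⟨z₁, z₂, z₃, z₄, z₅, z₆⟩ h' heq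
      simp only [coe_filter, Set.mem_ofPred_eq, Prod.mk.injEq] at h h' heq ⊢
      grind
  have step₂ : #((poorTuples G).image fun p => (p.1, p.2.1, p.2.2.2.2.1, p.2.2.2.2.2)) ≤
      25 * #(univ : Finset (V × V)) := by
    refine card_le_mul_card_image_of_maps_to (f := fun p => (p.1, p.2.2.2)) (by simp) _ ?_
    rintro ⟨x₁, x₆⟩ -
    rcases ({p ∈ (poorTuples G).image fun p => (p.1, p.2.1, p.2.2.2.2.1, p.2.2.2.2.2) |
      (p.1, p.2.2.2) = (x₁, x₆)}).eq_empty_or_nonempty with h0 | ⟨⟨y₁, y₂, y₅, y₆⟩, h0⟩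
    · rw [h0]; simp
    simp only [mem_filter, mem_image, Prod.mk.injEq, Prod.exists, poorTuples,
      mem_pathTuples] at h0
    obtain ⟨⟨a₁, a₂, a₃, a₄, a₅, a₆, ⟨hp, -⟩, rfl, rfl, rfl, rfl⟩, rfl, rfl⟩ := h0
    have hd := Nat.mul_le_mul (card_nbrs_end_le hG hp) (card_nbrs_end_le hG hp.reverse)
    rw [← card_product] at hd
    refine le_trans ?_ hd
    refine card_le_card_of_injOn (fun p => (p.2.1, p.2.2.1)) ?_ ?_
    · rintro ⟨b₁, b₂, b₅, b₆⟩ h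
      simp only [coe_filter, Set.mem_ofPred_eq, mem_image, Prod.mk.injEq, Prod.exists, poorTuples,
        mem_pathTuples, mem_filter] at h
      obtain ⟨⟨c₁, c₂, c₃, c₄, c₅, c₆, ⟨hq, -⟩, rfl, rfl, rfl, rfl⟩, rfl, rfl⟩ := h
      simp only [coe_product, Set.mem_prod, mem_coe, mem_nbrs]
      exact ⟨hq.1, hq.2.2.2.2.1.symm⟩
    · rintro ⟨y₁, y₂, y₃, y₄⟩ h ⟨z₁, z₂, z₃, z₄⟩ h' heq
      simp only [coe_filter, Set.mem_ofPred_eq, Prod.mk.injEq] at h h' heq ⊢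
      grind
  rw [card_univ, Fintype.card_prod, ← sq] at step₂
  omega

lemma card_pathTuples_le_add :
    #(pathTuples G) ≤ #(poorTuples G) + 2 * #(richTuples G) := by
  classical
  have hsub : pathTuples G ⊆ poorTuples G ∪ (richTuples G ∪ (richTuples G).image
      fun p => (p.2.2.2.2.2, p.2.2.2.2.1, p.2.2.2.1, p.2.2.1, p.2.1, p.1)) := by
    rintro ⟨x₁, x₂, x₃, x₄, x₅, x₆⟩ h
    simp only [mem_union, mem_image, poorTuples, richTuples, mem_filter]
    by_cases h1 : RichPair G x₂ x₄
    · exact Or.inr (Or.inl ⟨h, h1⟩)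
    by_cases h2 : RichPair G x₃ x₅
    · exact Or.inr (Or.inr ⟨(x₆, x₅, x₄, x₃, x₂, x₁),
        ⟨mem_pathTuples.mpr (mem_pathTuples.mp h).reverse, h2.symm⟩, rfl⟩)
    · exact Or.inl ⟨h, h1, h2⟩
  have h1 := (card_le_card hsub).trans (card_union_le _ _)
  have h2 := card_union_le (richTuples G) ((richTuples G).image
      fun p => (p.2.2.2.2.2, p.2.2.2.2.1, p.2.2.2.1, p.2.2.1, p.2.1, p.1))
  have h3 := card_image_le (s := richTuples G)
    (f := fun p => (p.2.2.2.2.2, p.2.2.2.2.1, p.2.2.2.1, p.2.2.1, p.2.1, p.1))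
  omega

open scoped Classical in
/-- The pairs `(v, b)` such that `w v b` is a path avoiding `u`. -/
noncomputable def hangingPairs (G : SimpleGraph V) (u w : V) : Finset (V × V) :=
  {q | G.Adj w q.1 ∧ G.Adj q.1 q.2 ∧ q.1 ≠ u ∧ q.2 ≠ u ∧ q.2 ≠ w}

lemma mem_hangingPairs {u w v b : V} : (v, b) ∈ hangingPairs G u w ↔
    G.Adj w v ∧ G.Adj v b ∧ v ≠ u ∧ b ≠ u ∧ b ≠ w := by simp [hangingPairs]

open scoped Classical in
lemma card_closing_le (hG : NoPathSeven G) {u w : V} (hr : RichPair G u w) :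
    #{q ∈ hangingPairs G u w | G.Adj u q.2} ≤ 4 := by
  refine card_le_of_pairs_meet (k := 1) ?_ ?_ ?_
  · intro x y x' y' h h'
    simp only [mem_filter, mem_hangingPairs] at h h'
    exact closing_pairs_meet hG hr h.1.1 h.1.2.1 h.1.2.2.1 h.1.2.2.2.2 h'.1.1 h'.1.2.1
      h'.1.2.2.1 h'.1.2.2.2.2 h.2 h'.2
  · intro z
    rw [card_le_one]
    rintro ⟨x, y⟩ h ⟨x', y'⟩ h'
    simp only [mem_filter, mem_hangingPairs] at h h'
    obtain ⟨⟨⟨h1, h2, h3, h4, h5⟩, h6⟩, rfl⟩ := h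
    obtain ⟨⟨⟨h1', h2', h3', h4', h5'⟩, h6'⟩, rfl⟩ := h'
    rw [closing_determined hG hr h1 h2 h3 h5 h2' h5' h6 h6']
  · intro z
    rw [card_le_one]
    rintro ⟨x, y⟩ h ⟨x', y'⟩ h'
    simp only [mem_filter, mem_hangingPairs] at h h'
    obtain ⟨⟨⟨h1, h2, h3, h4, h5⟩, h6⟩, rfl⟩ := h
    obtain ⟨⟨⟨h1', h2', h3', h4', h5'⟩, h6'⟩, rfl⟩ := h'
    rw [hanging_determined hG hr h1 h2 h3 h4 h5 h1' h2' h3']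

open scoped Classical in
lemma card_hangingPairs_eq (u w : V) : #(hangingPairs G u w) =
    #{q ∈ hangingPairs G u w | G.Adj u q.2} + #{q ∈ hangingPairs G u w | ¬ G.Adj u q.2} :=
  (card_filter_add_card_filter_not _).symm

/-- At most four hanging pairs are closing. The others are determined by `b`, a non-neighbour of
`u`. -/
lemma card_hangingPairs_add_card_nbrs_le (hG : NoPathSeven G) {u w : V} (hr : RichPair G u w) :
    #(hangingPairs G u w) + #(nbrs G u) ≤ Fintype.card V + 4 := by
  classical
  have h1 := card_closing_le hG hr
  have h2 := card_hangingPairs_eq (G := G) u w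
  have h3 : #{q ∈ hangingPairs G u w | ¬ G.Adj u q.2} ≤ #({y | ¬ G.Adj u y} : Finset V) := by
    refine card_le_card_of_injOn Prod.snd ?_ ?_
    · rintro ⟨v, b⟩ h
      simpa using (mem_filter.mp h).2
    · rintro ⟨x, y⟩ h ⟨x', y'⟩ h' heq
      simp only [coe_filter, Set.mem_ofPred_eq, mem_hangingPairs] at h h' heq
      subst heq
      obtain ⟨⟨h1, h2, h3, h4, h5⟩, h6⟩ := h
      obtain ⟨⟨h1', h2', h3', h4', h5'⟩, h6'⟩ := h'
      rw [hanging_determined hG hr h1 h2 h3 h4 h5 h1' h2' h3']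
  have h4 : #(nbrs G u) + #({y | ¬ G.Adj u y} : Finset V) = Fintype.card V :=
    card_filter_add_card_filter_not _
  omega

/-- `G` contains a rich pair `u w` and a common neighbour `v` with two further
neighbours. -/
def HasBroom (G : SimpleGraph V) : Prop :=
  ∃ u w v b b' : V, RichPair G u w ∧ G.Adj u v ∧ G.Adj w v ∧ G.Adj v b ∧ G.Adj v b' ∧
    b ≠ u ∧ b ≠ w ∧ b' ≠ u ∧ b' ≠ w ∧ b ≠ b'

open scoped Classical in
-- An open edge on the other side forces every open edge here to have the same inner vertex, which
-- is then a common neighbour of `u` and `w`; two open edges there would form a broom.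
lemma card_open_hanging_le_one (hG : NoPathSeven G) (hB : ¬ HasBroom G) {u w : V}
    (hr : RichPair G u w)
    (hne : ({q ∈ hangingPairs G w u | ¬ G.Adj w q.2} : Finset _).Nonempty) :
    #{q ∈ hangingPairs G u w | ¬ G.Adj u q.2} ≤ 1 := by
  obtain ⟨⟨v', b'⟩, hvb⟩ := hne
  simp only [mem_filter, mem_hangingPairs] at hvb
  obtain ⟨⟨h1', h2', h3', h4', h5'⟩, h6'⟩ := hvb
  rw [card_le_one]
  have key : ∀ v b, (v, b) ∈ ({q ∈ hangingPairs G u w | ¬ G.Adj u q.2} : Finset _) → v = v' := by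
    intro v b h
    simp only [mem_filter, mem_hangingPairs] at h
    obtain ⟨⟨h1, h2, h3, h4, h5⟩, h6⟩ := h
    exact open_hanging_inner_eq hG hr h1 h2 h3 h4 h5 h6 h1' h2' h3' h5' h4' h6'
  rintro ⟨v, b⟩ h ⟨x, c⟩ h'
  obtain rfl := key v b h
  obtain rfl := key x c h'
  simp only [mem_filter, mem_hangingPairs] at h h'
  by_contra hbc
  exact hB ⟨u, w, x, b, c, hr, h1', h.1.1, h.1.2.1, h'.1.2.1, h.1.2.2.2.1, h.1.2.2.2.2,
    h'.1.2.2.2.1, h'.1.2.2.2.2, fun e => hbc (by rw [e])⟩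

lemma card_hangingPairs_trichotomy (hG : NoPathSeven G) (hB : ¬ HasBroom G) {u w : V}
    (hr : RichPair G u w) : #(hangingPairs G u w) ≤ 4 ∨ #(hangingPairs G w u) ≤ 4 ∨
      (#(hangingPairs G u w) ≤ 5 ∧ #(hangingPairs G w u) ≤ 5) := by
  classical
  have h1 := card_closing_le hG hr
  have h2 := card_hangingPairs_eq (G := G) u w
  have h1' := card_closing_le hG hr.symm
  have h2' := card_hangingPairs_eq (G := G) w u
  rcases ({q ∈ hangingPairs G w u | ¬ G.Adj w q.2} : Finset _).eq_empty_or_nonempty with h | h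
  · rw [h, card_empty] at h2'
    omega
  rcases ({q ∈ hangingPairs G u w | ¬ G.Adj u q.2} : Finset _).eq_empty_or_nonempty with h' | h'
  · rw [h', card_empty] at h2
    omega
  have h3 := card_open_hanging_le_one hG hB hr h
  have h3' := card_open_hanging_le_one hG hB hr.symm h'
  omega

/-- Here `d`, `e` are the degrees of `u`, `w`, and `p`, `q` the hanging counts. One product is
bounded by AM-GM and the other is linear, or both are at most `5 n`; hence `40 n = 4 (5 n + 5 n)`.
-/
lemma four_mul_two_products_le {n d e p q : ℕ} (h₁ : p + d ≤ n + 4) (h₂ : q + e ≤ n + 4)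
    (hd : d ≤ n) (he : e ≤ n) (h : p ≤ 4 ∨ q ≤ 4 ∨ (p ≤ 5 ∧ q ≤ 5)) :
    4 * (d * p + e * q) ≤ (n + 4) ^ 2 + 40 * n := by
  have amgm : ∀ {x y : ℕ}, x + y ≤ n + 4 → 4 * (y * x) ≤ (n + 4) ^ 2 := by
    intro x y hxy
    calc 4 * (y * x) ≤ (x + y) ^ 2 := by
          zify; nlinarith [sq_nonneg ((x : ℤ) - y)]
      _ ≤ (n + 4) ^ 2 := Nat.pow_le_pow_left hxy 2
  have := amgm h₁
  have := amgm h₂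
  rcases h with h | h | ⟨h, h'⟩
  · have := Nat.mul_le_mul hd h
    omega
  · have := Nat.mul_le_mul he h
    omega
  · have := Nat.mul_le_mul hd h
    have := Nat.mul_le_mul he h'
    omega

lemma card_richTuples_le (hG : NoPathSeven G) (hB : ¬ HasBroom G) :
    4 * #(richTuples G) ≤ Fintype.card V * ((Fintype.card V + 4) ^ 2 + 40 * Fintype.card V) := by
  classical
  have key : ∀ c ∈ (univ : Finset V),
      4 * #{p ∈ richTuples G | p.2.2.1 = c} ≤
        (Fintype.card V + 4) ^ 2 + 40 * Fintype.card V := by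
    rintro c -
    rcases ({p ∈ richTuples G | p.2.2.1 = c}).eq_empty_or_nonempty with h0 | ⟨p, h0⟩
    · rw [h0]; simp
    obtain ⟨x₁, u, x₃, w, x₅, x₆⟩ := p
    simp only [richTuples, mem_filter, mem_pathTuples] at h0
    obtain ⟨⟨hp, hr⟩, rfl⟩ := h0
    have hsub : {p ∈ richTuples G | p.2.2.1 = x₃} ⊆
        ((nbrs G u ×ˢ hangingPairs G u w).image fun q => (q.1, u, x₃, w, q.2.1, q.2.2)) ∪
        ((nbrs G w ×ˢ hangingPairs G w u).image fun q => (q.1, w, x₃, u, q.2.1, q.2.2)) := by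
      rintro ⟨y₁, u', y₃, w', v, b⟩ h
      simp only [richTuples, mem_filter, mem_pathTuples] at h
      obtain ⟨⟨hp', hr'⟩, rfl⟩ := h
      have hmem : y₁ ∈ nbrs G u' ∧ (v, b) ∈ hangingPairs G u' w' := by
        have hn := hp'.2.2.2.2.2
        simp only [List.nodup_cons, List.mem_cons, not_or] at hn
        exact ⟨mem_nbrs.mpr hp'.1.symm, mem_hangingPairs.mpr ⟨hp'.2.2.2.1, hp'.2.2.2.2.1,
          by tauto, by tauto, by tauto⟩⟩
      have := richPair_unique hG hr hr' hp.2.1 hp.2.2.1.symm hp'.2.1 hp'.2.2.1.symm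
      simp only [mem_union, mem_image, mem_product, Prod.exists, Prod.mk.injEq]
      rcases this with ⟨rfl, rfl⟩ | ⟨rfl, rfl⟩
      · exact Or.inl ⟨y₁, v, b, hmem, by simp⟩
      · exact Or.inr ⟨y₁, v, b, hmem, by simp⟩
    have hc := ((card_le_card hsub).trans (card_union_le _ _)).trans
      (Nat.add_le_add card_image_le card_image_le)
    rw [card_product, card_product] at hc
    refine (Nat.mul_le_mul_left 4 hc).trans (four_mul_two_products_le
      (card_hangingPairs_add_card_nbrs_le hG hr) (card_hangingPairs_add_card_nbrs_le hG hr.symm)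
      (card_le_univ _) (card_le_univ _) (card_hangingPairs_trichotomy hG hB hr))
  rw [card_eq_sum_card_fiberwise (f := fun p => p.2.2.1) (t := univ) (by simp), mul_sum]
  exact (sum_le_card_nsmul _ _ _ key).trans (by simp)

/-- Without a broom, the number of paths is at most `n³ / 4 + O(n²)`. -/
lemma card_pathTuples_le_of_not_hasBroom (hG : NoPathSeven G) (hB : ¬ HasBroom G) :
    2 * #(pathTuples G) ≤ Fintype.card V ^ 3 + 2000 * Fintype.card V ^ 2 := by
  have h1 := card_poorTuples_le hG
  have h2 := card_pathTuples_le_add (G := G)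
  have h3 := card_richTuples_le hG hB
  nlinarith [Nat.le_self_pow (two_ne_zero) (Fintype.card V)]

end Counting

/-! ### Paths in a two-sets structure -/

/-- Every edge of `G` meeting `{u, w, v} ∪ A ∪ B` is an edge of the graph consisting of the
triangle `v u w`, the edges from `u` and `w` to `A` and the edges from `v` to `B`. -/
structure IsTwoSets {V : Type*} (G : SimpleGraph V) (u w v : V) (A B : Finset V) : Prop where
  adj_A : ∀ a ∈ A, ∀ y, G.Adj a y → y = u ∨ y = w
  adj_B : ∀ b ∈ B, ∀ y, G.Adj b y → y = v
  adj_u : ∀ y, G.Adj u y → y ∈ A ∨ y = w ∨ y = v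
  adj_w : ∀ y, G.Adj w y → y ∈ A ∨ y = u ∨ y = v
  adj_v : ∀ y, G.Adj v y → y ∈ B ∨ y = u ∨ y = w
  ne_uw : u ≠ w
  ne_uv : u ≠ v
  ne_wv : w ≠ v
  u_notMem_A : u ∉ A
  w_notMem_A : w ∉ A
  v_notMem_A : v ∉ A
  u_notMem_B : u ∉ B
  w_notMem_B : w ∉ B
  v_notMem_B : v ∉ B
  disj : Disjoint A B

/-- The paths `a u a' w v b` and `a w a' u v b`. -/
def IsTwoSetsPath {V : Type*} (u w v : V) (A B : Finset V) (x₁ x₂ x₃ x₄ x₅ x₆ : V) : Prop :=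
  x₁ ∈ A ∧ x₃ ∈ A ∧ x₁ ≠ x₃ ∧ x₅ = v ∧ x₆ ∈ B ∧ ((x₂ = u ∧ x₄ = w) ∨ (x₂ = w ∧ x₄ = u))

section TwoSets

variable {V : Type*} {G : SimpleGraph V} {u w v : V} {A B : Finset V}

/-- The path stays inside the structure. As `A ∪ B` is independent, it holds at most three of the
six vertices, so `u`, `w`, `v` all occur. If `v` were an end or lay between `u` and `w`, at most
five vertices could be used; so `v` is next to some `b ∈ B`, which is an end. -/
lemma IsTwoSets.path_cases (h : IsTwoSets G u w v A B) {x₁ x₂ x₃ x₄ x₅ x₆ : V}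
    (hp : IsPathSix G x₁ x₂ x₃ x₄ x₅ x₆)
    (hx : x₁ ∈ A ∨ x₁ ∈ B ∨ x₁ = u ∨ x₁ = w ∨ x₁ = v) :
    IsTwoSetsPath u w v A B x₁ x₂ x₃ x₄ x₅ x₆ ∨ IsTwoSetsPath u w v A B x₆ x₅ x₄ x₃ x₂ x₁ := by
  obtain ⟨hA, hB, hu, hw, hv, n1, n2, n3, a1, a2, a3, b1, b2, b3, -⟩ := h
  obtain ⟨h1, h2, h3, h4, h5, hn⟩ := hp
  simp only [List.nodup_cons, List.mem_cons, List.not_mem_nil, not_or] at hn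
  unfold IsTwoSetsPath
  rcases hx with hx | hx | rfl | rfl | rfl
  · rcases hA _ hx _ h1 with rfl | rfl
    · rcases hu _ h2 with h | rfl | rfl
      · have := hA _ h _ h3; grind
      · have := hw _ h3; grind
      · have := hv _ h3; grind
    · rcases hw _ h2 with h | rfl | rfl
      · have := hA _ h _ h3; grind
      · have := hu _ h3; grind
      · have := hv _ h3; grind
  · obtain rfl := hB _ hx _ h1
    rcases hv _ h2 with h | rfl | rfl
    · have := hB _ h _ h3; grind
    · have := hu _ h3; grind
    · have := hw _ h3; grind
  · rcases hu _ h1 with h | rfl | rfl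
    · have := hA _ h _ h2; grind
    · have := hw _ h2; grind
    · have := hv _ h2; grind
  · rcases hw _ h1 with h | rfl | rfl
    · have := hA _ h _ h2; grind
    · have := hu _ h2; grind
    · have := hv _ h2; grind
  · rcases hv _ h1 with h | rfl | rfl
    · have := hB _ h _ h2; grind
    · have := hu _ h2; grind
    · have := hw _ h2; grind

/-- The ordered path with orientation `s.1.1`, with `u` before `w` or after according to `s.1.2`,
and with the remaining vertices given by `s.2`. -/
def twoSetsTuple (u w v : V) (s : (Bool × Bool) × (V × V) × V) : V × V × V × V × V × V :=
  let c := if s.1.2 then u else w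
  let c' := if s.1.2 then w else u
  if s.1.1 then (s.2.1.1, c, s.2.1.2, c', v, s.2.2) else (s.2.2, v, c', s.2.1.2, c, s.2.1.1)

open scoped Classical in
/-- The candidates for the ordered paths in a two-sets structure. -/
noncomputable def twoSetsTuples (u w v : V) (A B : Finset V) : Finset (V × V × V × V × V × V) :=
  ((univ : Finset (Bool × Bool)) ×ˢ A.offDiag ×ˢ B).image (twoSetsTuple u w v)

lemma mem_twoSetsTuples {x₁ x₂ x₃ x₄ x₅ x₆ : V} :
    (x₁, x₂, x₃, x₄, x₅, x₆) ∈ twoSetsTuples u w v A B ↔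
      IsTwoSetsPath u w v A B x₁ x₂ x₃ x₄ x₅ x₆ ∨ IsTwoSetsPath u w v A B x₆ x₅ x₄ x₃ x₂ x₁ := by
  simp only [twoSetsTuples, mem_image, mem_product, mem_univ, true_and, mem_offDiag, Prod.exists,
    twoSetsTuple, IsTwoSetsPath, Bool.exists_bool]
  simp only [Bool.false_eq_true, if_false, if_true, Prod.mk.injEq]
  constructor
  · rintro (h | h)
    · obtain ⟨a, c, b, h⟩ | ⟨a, c, b, h⟩ := h <;> grind
    · obtain ⟨a, c, b, h⟩ | ⟨a, c, b, h⟩ := h <;> grind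
  · rintro (⟨h1, h2, h3, h4, h5, h6 | h6⟩ | ⟨h1, h2, h3, h4, h5, h6 | h6⟩)
    · exact Or.inr (Or.inr ⟨x₁, x₃, x₆, by simp [*]⟩)
    · exact Or.inr (Or.inl ⟨x₁, x₃, x₆, by simp [*]⟩)
    · exact Or.inl (Or.inr ⟨x₆, x₄, x₁, by simp [*]⟩)
    · exact Or.inl (Or.inl ⟨x₆, x₄, x₁, by simp [*]⟩)

lemma card_twoSetsIndex (A B : Finset V) [DecidableEq V] :
    #((univ : Finset (Bool × Bool)) ×ˢ A.offDiag ×ˢ B) = 4 * (#A * (#A - 1) * #B) := by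
  rw [card_product, card_product, offDiag_card, card_univ, Nat.mul_sub_one]
  simp

lemma card_twoSetsTuples_le : #(twoSetsTuples u w v A B) ≤ 4 * (#A * (#A - 1) * #B) := by
  classical
  exact card_image_le.trans (card_twoSetsIndex A B).le

lemma card_twoSetsTuples (hne : u ≠ w) (hd : Disjoint A B) :
    #(twoSetsTuples u w v A B) = 4 * (#A * (#A - 1) * #B) := by
  classical
  rw [← card_twoSetsIndex A B]
  refine card_image_of_injOn ?_
  rintro ⟨⟨s, t⟩, ⟨a, c⟩, b⟩ h ⟨⟨s', t'⟩, ⟨a', c'⟩, b'⟩ h' heq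
  simp only [coe_product, Set.mem_prod, mem_coe, mem_offDiag] at h h'
  have := disjoint_left.mp hd
  cases s <;> cases t <;> cases s' <;> cases t' <;> simp [twoSetsTuple] at heq ⊢ <;> grind

end TwoSets

/-! ### The component of a broom -/

section Broom

variable {V : Type*} {G : SimpleGraph V} {u w v : V}

lemma not_adj_of_broom (hG : NoPathSeven G) (hr : RichPair G u w) {x y : V}
    (hvx : G.Adj v x) (hvy : G.Adj v y) (hxy : x ≠ y) (hvu : v ≠ u) (hvw : v ≠ w)
    (hxw : x ≠ w) (hyu : y ≠ u) (hyw : y ≠ w) : ¬ G.Adj u x := by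
  intro hux
  obtain ⟨a, hua, hwa, ha⟩ := hr.exists_common [v, x, y] (by simp)
  obtain ⟨c, huc, hwc, hc⟩ := hr.exists_common [v, x, y, a] (by simp)
  refine hG y v x u a w c hvy.symm hvx hux.symm hua hwa.symm hwc ?_
  have := hr.1
  simp only [List.nodup_cons, List.mem_cons, List.not_mem_nil, not_or] at *
  grind [G.ne_of_adj]

lemma leaf_of_broom (hG : NoPathSeven G) (hr : RichPair G u w) {x y : V}
    (hwv : G.Adj w v) (hvx : G.Adj v x) (hvu : v ≠ u) (hxu : x ≠ u) (hxw : x ≠ w)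
    (hux : ¬ G.Adj u x) (hwx : ¬ G.Adj w x) (hxy : G.Adj x y) : y = v := by
  by_contra hyv
  obtain ⟨a, hua, hwa, ha⟩ := hr.exists_common [v, x, y] (by simp)
  obtain ⟨c, huc, hwc, hc⟩ := hr.exists_common [v, x, y, a] (by simp)
  have h1 : y ≠ u := by rintro rfl; exact hux hxy.symm
  have h2 : y ≠ w := by rintro rfl; exact hwx hxy.symm
  refine hG y x v w a u c hxy.symm hvx.symm hwv.symm hwa hua.symm huc ?_
  have := hr.1
  simp only [List.nodup_cons, List.mem_cons, List.not_mem_nil, not_or] at *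
  grind [G.ne_of_adj]

lemma common_nbrs_of_broom (hG : NoPathSeven G) (hr : RichPair G u w) {x a y : V}
    (hwv : G.Adj w v) (hvx : G.Adj v x) (hvu : v ≠ u) (hxu : x ≠ u) (hxw : x ≠ w)
    (hux : ¬ G.Adj u x) (hxl : ∀ y, G.Adj x y → y = v) (hua : G.Adj u a) (hav : a ≠ v)
    (hva : ¬ G.Adj v a) (haw : a ≠ w) (hay : G.Adj a y) (hyw : y ≠ w) : y = u := by
  by_contra hyu
  obtain ⟨c, huc, hwc, hc⟩ := hr.exists_common [v, x, y, a] (by simp)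
  have h1 : y ≠ v := by rintro rfl; exact hva hay.symm
  have h2 : x ≠ y := by rintro rfl; exact hav (hxl _ hay.symm)
  have h3 : x ≠ a := by rintro rfl; exact hux hua
  refine hG y a u c w v x hay.symm hua.symm huc hwc.symm hwv hvx ?_
  have := hr.1
  simp only [List.nodup_cons, List.mem_cons, List.not_mem_nil, not_or] at *
  grind [G.ne_of_adj]

/-- The component of a broom is contained in a graph `S^{(3)}_{a,b}`. -/
lemma HasBroom.exists_isTwoSets [Fintype V] (hG : NoPathSeven G) (hB : HasBroom G) :
    ∃ (u w v : V) (A B : Finset V), IsTwoSets G u w v A B ∧ 2 ≤ #A ∧ 1 ≤ #B := by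
  classical
  obtain ⟨u, w, v, b, b', hr, huv, hwv, hvb, hvb', hbu, hbw, hbu', hbw', hbb⟩ := hB
  have huw := hr.1
  have hvu := huv.ne'
  have hvw := hwv.ne'
  -- Of `b` and `b'`, one differs from `x`; this is why a broom has two bristles.
  have nu : ∀ x, G.Adj v x → x ≠ w → ¬ G.Adj u x := by
    intro x hvx hxw
    by_cases hx : x = b
    · subst hx
      exact not_adj_of_broom hG hr hvx hvb' hbb hvu hvw hxw hbu' hbw'
    · exact not_adj_of_broom hG hr hvx hvb hx hvu hvw hxw hbu hbw
  have nw : ∀ x, G.Adj v x → x ≠ u → ¬ G.Adj w x := by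
    intro x hvx hxu
    by_cases hx : x = b
    · subst hx
      exact not_adj_of_broom hG hr.symm hvx hvb' hbb hvw hvu hxu hbw' hbu'
    · exact not_adj_of_broom hG hr.symm hvx hvb hx hvw hvu hxu hbw hbu
  have leaf : ∀ x, G.Adj v x → x ≠ u → x ≠ w → ∀ y, G.Adj x y → y = v :=
    fun x hvx hxu hxw y hxy => leaf_of_broom hG hr hwv hvx hvu hxu hxw (nu x hvx hxw)
      (nw x hvx hxu) hxy
  have au : ∀ a, G.Adj u a → a ≠ v → a ≠ w → ∀ y, G.Adj a y → y = u ∨ y = w := by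
    intro a hua hav haw y hay
    by_cases hyw : y = w
    · exact Or.inr hyw
    · exact Or.inl (common_nbrs_of_broom hG hr hwv hvb hvu hbu hbw (nu b hvb hbw)
        (leaf b hvb hbu hbw) hua hav (fun h => nu a h haw hua) haw hay hyw)
  have aw : ∀ a, G.Adj w a → a ≠ v → a ≠ u → ∀ y, G.Adj a y → y = u ∨ y = w := by
    intro a hwa hav hau y hay
    by_cases hyu : y = u
    · exact Or.inl hyu
    · exact Or.inr (common_nbrs_of_broom hG hr.symm huv hvb hvw hbw hbu (nw b hvb hbu)
        (leaf b hvb hbu hbw) hwa hav (fun h => nw a h hau hwa) hau hay hyu)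
  -- Vertices adjacent to only one of `u`, `w` also go into `A`: only containment in `S^{(3)}_{a,b}`
  -- is required.
  refine ⟨u, w, v, (nbrs G u ∪ nbrs G w) \ {u, w, v}, nbrs G v \ {u, w}, ?_, ?_, ?_⟩
  · constructor
    · intro a ha y hay
      simp only [mem_sdiff, mem_union, mem_nbrs, mem_insert, mem_singleton, not_or] at ha
      obtain ⟨ha | ha, h1, h2, h3⟩ := ha
      · exact au a ha h3 h2 y hay
      · exact aw a ha h3 h1 y hay
    · intro x hx y hxy
      simp only [mem_sdiff, mem_nbrs, mem_insert, mem_singleton, not_or] at hx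
      exact leaf x hx.1 hx.2.1 hx.2.2 y hxy
    · intro y hy
      have := hy.ne'
      simp only [mem_sdiff, mem_union, mem_nbrs, mem_insert, mem_singleton, not_or]
      tauto
    · intro y hy
      have := hy.ne'
      simp only [mem_sdiff, mem_union, mem_nbrs, mem_insert, mem_singleton, not_or]
      tauto
    · intro y hy
      simp only [mem_sdiff, mem_nbrs, mem_insert, mem_singleton, not_or]
      tauto
    · exact huw
    · exact huv.ne
    · exact hwv.ne
    all_goals try simp
    rw [disjoint_left]
    intro x hx hx'
    simp only [mem_sdiff, mem_union, mem_nbrs, mem_insert, mem_singleton, not_or] at hx hx'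
    obtain ⟨h | h, -⟩ := hx
    · exact nu x hx'.1 hx'.2.2 h
    · exact nw x hx'.1 hx'.2.1 h
  · obtain ⟨a, hua, hwa, ha⟩ := hr.exists_common [v] (by simp)
    obtain ⟨c, huc, hwc, hc⟩ := hr.exists_common [v, a] (by simp)
    simp only [List.mem_cons, List.not_mem_nil, not_or] at ha hc
    have hne : c ≠ a := hc.2.1
    rw [← card_pair hne]
    refine card_le_card fun x hx => ?_
    have := hua.ne'; have := hwa.ne'; have := huc.ne'; have := hwc.ne'
    simp only [mem_insert, mem_singleton] at hx
    simp only [mem_sdiff, mem_union, mem_nbrs, mem_insert, mem_singleton, not_or]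
    rcases hx with rfl | rfl <;> tauto
  · rw [Nat.one_le_iff_ne_zero, card_ne_zero]
    exact ⟨b, by simp [hvb, hbu, hbw]⟩

/-- The vertices of a two-sets structure. -/
def twoSetsVertices (u w v : V) (A B : Finset V) [DecidableEq V] : Finset V := {u, w, v} ∪ (A ∪ B)

lemma IsTwoSets.card_vertices {A B : Finset V} [DecidableEq V] (h : IsTwoSets G u w v A B) :
    #(twoSetsVertices u w v A B) = #A + #B + 3 := by
  rw [twoSetsVertices, card_union_of_disjoint, card_union_of_disjoint h.disj,
    card_eq_three.mpr ⟨u, w, v, h.ne_uw, h.ne_uv, h.ne_wv, rfl⟩, add_comm]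
  rw [disjoint_left]
  have := h.u_notMem_A; have := h.w_notMem_A; have := h.v_notMem_A
  have := h.u_notMem_B; have := h.w_notMem_B; have := h.v_notMem_B
  intro x hx
  simp only [mem_insert, mem_singleton, mem_union, not_or] at hx ⊢
  rcases hx with rfl | rfl | rfl <;> tauto

lemma IsTwoSets.mem_vertices_of_adj {A B : Finset V} [DecidableEq V]
    (h : IsTwoSets G u w v A B) {x y : V} (hx : x ∈ twoSetsVertices u w v A B)
    (hxy : G.Adj x y) : y ∈ twoSetsVertices u w v A B := by
  simp only [twoSetsVertices, mem_insert, mem_singleton, mem_union] at hx ⊢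
  rcases hx with (rfl | rfl | rfl) | hx | hx
  · have := h.adj_u y hxy; tauto
  · have := h.adj_w y hxy; tauto
  · have := h.adj_v y hxy; tauto
  · have := h.adj_A x hx y hxy; tauto
  · have := h.adj_B x hx y hxy; tauto

/-- Removing a two-sets structure destroys at most `2 a (a - 1) b` paths. -/
lemma IsTwoSets.card_pathTuples_le [Fintype V] [DecidableEq V] {A B : Finset V}
    (h : IsTwoSets G u w v A B) :
    #(pathTuples G) ≤ 4 * (#A * (#A - 1) * #B) +
      #(pathTuples (G.induce {x | x ∉ twoSetsVertices u w v A B})) := by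
  set X := twoSetsVertices u w v A B with hX
  -- The structure is closed under adjacency, so a path lies wholly inside it or wholly outside.
  have hsub : pathTuples G ⊆ twoSetsTuples u w v A B ∪
      (pathTuples (G.induce {x | x ∉ X})).image fun p =>
        (p.1.1, p.2.1.1, p.2.2.1.1, p.2.2.2.1.1, p.2.2.2.2.1.1, p.2.2.2.2.2.1) := by
    rintro ⟨x₁, x₂, x₃, x₄, x₅, x₆⟩ hp
    rw [mem_pathTuples] at hp
    rw [mem_union]
    by_cases hx : x₁ ∈ X
    · left
      refine mem_twoSetsTuples.mpr (h.path_cases hp ?_)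
      simp only [hX, twoSetsVertices, mem_insert, mem_singleton, mem_union] at hx
      tauto
    · right
      obtain ⟨h1, h2, h3, h4, h5, hn⟩ := hp
      have step : ∀ {x y}, x ∉ X → G.Adj x y → y ∉ X := fun hx hxy hy =>
        hx (h.mem_vertices_of_adj hy hxy.symm)
      have hx2 := step hx h1
      have hx3 := step hx2 h2
      have hx4 := step hx3 h3
      have hx5 := step hx4 h4
      have hx6 := step hx5 h5
      refine mem_image.mpr ⟨(⟨x₁, hx⟩, ⟨x₂, hx2⟩, ⟨x₃, hx3⟩, ⟨x₄, hx4⟩, ⟨x₅, hx5⟩, ⟨x₆, hx6⟩),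
        mem_pathTuples.mpr ⟨h1, h2, h3, h4, h5, ?_⟩, rfl⟩
      exact List.Nodup.of_map Subtype.val hn
  exact ((card_le_card hsub).trans (card_union_le _ _)).trans
    (Nat.add_le_add card_twoSetsTuples_le card_image_le)

lemma NoPathSeven.induce (hG : NoPathSeven G) (s : Set V) : NoPathSeven (G.induce s) := by
  intro x₁ x₂ x₃ x₄ x₅ x₆ x₇ h1 h2 h3 h4 h5 h6 hn
  exact hG x₁ x₂ x₃ x₄ x₅ x₆ x₇ h1 h2 h3 h4 h5 h6 (hn.map Subtype.val_injective)

end Broom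

/-! ### Maximising `a (a - 1) b` -/

section Arithmetic

/-- The maximum of `a (a - 1) b` subject to `a + b + 3 = n`. -/
def maxProd (n : ℕ) : ℕ := (range n).sup fun a => a * (a - 1) * (n - 3 - a)

lemma le_maxProd {n a b : ℕ} (h : a + b + 3 = n) : a * (a - 1) * b ≤ maxProd n := by
  have hb : b = n - 3 - a := by omega
  rw [hb]
  exact le_sup (f := fun a => a * (a - 1) * (n - 3 - a)) (mem_range.mpr (by omega))

/-- Truncated subtraction makes the terms with `a ≥ n - 3` vanish, so a nonzero maximum comes from
an admissible pair. -/
lemma maxProd_eq_zero_or (n : ℕ) :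
    maxProd n = 0 ∨ ∃ a b, a + b + 3 = n ∧ 2 ≤ a ∧ 1 ≤ b ∧ maxProd n = a * (a - 1) * b := by
  by_cases h0 : maxProd n = 0
  · exact Or.inl h0
  right
  have hn : (range n).Nonempty := by
    rw [nonempty_range_iff]
    rintro rfl
    exact h0 rfl
  obtain ⟨a, -, h⟩ := exists_mem_eq_sup _ hn fun a => a * (a - 1) * (n - 3 - a)
  change maxProd n = _ at h
  have h1 : a * (a - 1) * (n - 3 - a) ≠ 0 := h ▸ h0
  have h2 : a - 1 ≠ 0 := by rintro e; simp [e] at h1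
  have h3 : n - 3 - a ≠ 0 := by rintro e; simp [e] at h1
  exact ⟨a, n - 3 - a, by omega, by omega, by omega, h⟩

lemma maxProd_pos {n : ℕ} (hn : 6 ≤ n) : 0 < maxProd n :=
  lt_of_lt_of_le (by simp; omega) (le_maxProd (a := 2) (b := n - 5) (by omega))

lemma exists_maxProd_eq {n : ℕ} (hn : 6 ≤ n) :
    ∃ a b, a + b + 3 = n ∧ 2 ≤ a ∧ 1 ≤ b ∧ maxProd n = a * (a - 1) * b :=
  (maxProd_eq_zero_or n).resolve_left (maxProd_pos hn).ne'

/-- If `maxProd t = 0`, then `t ≤ 5` and the `t` vertices join `A`. Otherwise merge both structures,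
`A` with `A` and `B` with `B`, and put the spare triangle into `A`. -/
lemma maxProd_superadditive {a b t : ℕ} (ha : 2 ≤ a) (hb : 1 ≤ b) (ht : 1 ≤ t) :
    2 * (a * (a - 1) * b) + 2 * maxProd t + (a + b + 3 + t) ≤
      2 * maxProd (a + b + 3 + t) + 12 := by
  obtain ⟨a, rfl⟩ := Nat.exists_eq_add_of_le' ha
  obtain ⟨b, rfl⟩ := Nat.exists_eq_add_of_le' hb
  rcases maxProd_eq_zero_or t with h0 | ⟨c, d, rfl, hc, hd, h⟩
  · have ht5 : t ≤ 5 := by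
      by_contra hc
      exact (maxProd_pos (by omega : 6 ≤ t)).ne' h0
    obtain ⟨t, rfl⟩ := Nat.exists_eq_add_of_le' ht
    have h1 := le_maxProd (n := a + 2 + (b + 1) + 3 + (t + 1)) (a := a + 2 + (t + 1)) (b := b + 1)
      (by omega)
    rw [show a + 2 - 1 = a + 1 by omega]
    rw [show a + 2 + (t + 1) - 1 = a + t + 2 by omega] at h1
    rw [h0]
    nlinarith [Nat.zero_le (a * b), Nat.zero_le (a * t), Nat.zero_le (b * t),
      Nat.zero_le (a * b * t), Nat.zero_le (t * t), Nat.zero_le (t * t * b)]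
  · obtain ⟨c, rfl⟩ := Nat.exists_eq_add_of_le' hc
    obtain ⟨d, rfl⟩ := Nat.exists_eq_add_of_le' hd
    have h1 := le_maxProd (n := a + 2 + (b + 1) + 3 + (c + 2 + (d + 1) + 3))
      (a := a + c + 7) (b := b + d + 2) (by omega)
    rw [h, show a + 2 - 1 = a + 1 by omega, show c + 2 - 1 = c + 1 by omega]
    rw [show a + c + 7 - 1 = a + c + 6 by omega] at h1
    refine le_trans ?_ (Nat.add_le_add_right (Nat.mul_le_mul_left 2 h1) 12)
    zify
    have e : (0 : ℤ) ≤ 2 * ((a + c + 7) * (a + c + 6) * (b + d + 2)) + 12 -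
        (2 * ((a + 2) * (a + 1) * (b + 1)) + 2 * ((c + 2) * (c + 1) * (d + 1)) +
        (a + 2 + (b + 1) + 3 + (c + 2 + (d + 1) + 3))) := by
      ring_nf
      positivity
    linarith

lemma maxProd_le (n : ℕ) : 27 * maxProd n ≤ 4 * n ^ 3 := by
  rcases maxProd_eq_zero_or n with h0 | ⟨a, b, rfl, -, -, h⟩
  · simp [h0]
  rw [h]
  calc 27 * (a * (a - 1) * b) ≤ 27 * (a * a * b) := by gcongr; omega
    _ ≤ 4 * (a + b) ^ 3 := by
      zify
      -- This product equals `4 (a + b)³ - 27 a² b`.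
      have : (0 : ℤ) ≤ ((a : ℤ) - 2 * b) ^ 2 * (4 * a + b) := by positivity
      nlinarith
    _ ≤ 4 * (a + b + 3) ^ 3 := Nat.mul_le_mul_left 4 (Nat.pow_le_pow_left (by omega) 3)

lemma le_maxProd_add (n : ℕ) : 4 * n ^ 3 ≤ 27 * maxProd n + 200 * n ^ 2 := by
  by_cases hn : n ≤ 50
  · have : 4 * n ^ 3 ≤ 200 * n ^ 2 := by
      rw [pow_succ, show 200 * n ^ 2 = 4 * (n ^ 2 * 50) by ring]
      gcongr
    omega
  obtain ⟨m, r, hr, rfl⟩ : ∃ m r, r < 3 ∧ n = 3 * (m + 3) + r :=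
    ⟨n / 3 - 3, n % 3, Nat.mod_lt _ (by norm_num), by omega⟩
  -- Near the optimum: `a ≈ 2n/3`, `b ≈ n/3`.
  have h1 := le_maxProd (n := 3 * (m + 3) + r) (a := 2 * m + 6) (b := m + r) (by omega)
  rw [show 2 * m + 6 - 1 = 2 * m + 5 by omega] at h1
  have h2 : (2 * m + 6) * (2 * m + 5) * m ≤ maxProd (3 * (m + 3) + r) :=
    le_trans (by gcongr; omega) h1
  have h3 : 4 * (3 * (m + 3) + r) ^ 3 ≤ 4 * (3 * m + 11) ^ 3 :=
    Nat.mul_le_mul_left 4 (Nat.pow_le_pow_left (by omega) 3)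
  have h4 : 200 * (3 * m + 9) ^ 2 ≤ 200 * (3 * (m + 3) + r) ^ 2 :=
    Nat.mul_le_mul_left 200 (Nat.pow_le_pow_left (by omega) 2)
  nlinarith

lemma cube_add_le_maxProd {n : ℕ} (hn : 12000 ≤ n) : n ^ 3 + 2000 * n ^ 2 ≤ 8 * maxProd n := by
  have h := le_maxProd_add n
  have : 12000 * n ^ 2 ≤ n ^ 3 := by rw [pow_succ n 2, mul_comm]; gcongr
  omega

end Arithmetic

/-! ### Induction by peeling off brooms -/

section UpperBound

lemma HasBroom.exists_reduction {V : Type} [Fintype V] {G : SimpleGraph V} (hG : NoPathSeven G)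
    (hB : HasBroom G) : ∃ (a b : ℕ) (W : Type) (_ : Fintype W) (G' : SimpleGraph W),
      2 ≤ a ∧ 1 ≤ b ∧ a + b + 3 + Fintype.card W = Fintype.card V ∧ NoPathSeven G' ∧
      #(pathTuples G) ≤ 4 * (a * (a - 1) * b) + #(pathTuples G') := by
  classical
  obtain ⟨u, w, v, A, B, h, hA, hB⟩ := hB.exists_isTwoSets hG
  refine ⟨#A, #B, {x | x ∉ twoSetsVertices u w v A B}, inferInstance, G.induce _, hA, hB, ?_,
    hG.induce _, h.card_pathTuples_le⟩
  rw [← h.card_vertices, ← Fintype.card_coe]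
  have := Fintype.card_subtype_compl (α := V) (fun x => x ∈ twoSetsVertices u w v A B)
  have h' := Fintype.card_subtype_le (α := V) (fun x => x ∈ twoSetsVertices u w v A B)
  change Fintype.card {x // x ∉ twoSetsVertices u w v A B} = _ at this
  change _ + Fintype.card {x // x ∉ twoSetsVertices u w v A B} = _
  omega

lemma card_eq_zero_of_isEmpty {V : Type*} [Fintype V] (h : Fintype.card V = 0)
    (G : SimpleGraph V) : #(pathTuples G) = 0 := by
  have := Fintype.card_eq_zero_iff.mp h
  exact card_eq_zero.mpr (eq_empty_of_forall_notMem fun p => isEmptyElim p.1)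

/-- The upper bound up to an additive constant. -/
lemma exists_card_pathTuples_le_add_const : ∃ M : ℕ, ∀ (n : ℕ) (V : Type) [Fintype V],
    Fintype.card V = n → ∀ G : SimpleGraph V, NoPathSeven G →
      #(pathTuples G) ≤ 4 * maxProd n + M := by
  obtain ⟨K, hK⟩ : ∃ K, K = 12000 := ⟨_, rfl⟩
  -- The constant covers broom-free graphs below the threshold of `cube_add_le_maxProd`.
  refine ⟨K ^ 3 + 2000 * K ^ 2, fun n => ?_⟩
  induction n using Nat.strong_induction_on with
  | _ n ih =>
  intro V _ hV G hG
  by_cases hB : HasBroom G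
  · obtain ⟨a, b, W, _, G', ha, hb, hc, hG', hle⟩ := hB.exists_reduction hG
    have h1 := ih (Fintype.card W) (by omega) W rfl G' hG'
    rw [hV] at hc
    rcases Nat.eq_zero_or_pos (Fintype.card W) with h0 | h0
    · rw [card_eq_zero_of_isEmpty h0] at hle
      have := le_maxProd (n := n) (a := a) (b := b) (by omega)
      omega
    · have := maxProd_superadditive ha hb h0
      rw [hc] at this
      -- From `n = 12` on, the linear gain outweighs the error 12. Below that, at most five vertices
      -- remain; they carry no term and are moved into `A`.
      by_cases hn : 12 ≤ n
      · omega
      · have h2 : maxProd (Fintype.card W) = 0 := by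
          rcases maxProd_eq_zero_or (Fintype.card W) with h | ⟨c, d, h3, h4, h5, -⟩
          · exact h
          · omega
        have := le_maxProd (n := n) (a := a + Fintype.card W) (b := b) (by omega)
        have : a * (a - 1) * b ≤ (a + Fintype.card W) * (a + Fintype.card W - 1) * b := by
          gcongr <;> omega
        omega
  · have h1 := card_pathTuples_le_of_not_hasBroom hG hB
    rw [hV] at h1
    by_cases hn : 12000 ≤ n
    · have := cube_add_le_maxProd hn
      omega
    · have : n ^ 3 + 2000 * n ^ 2 ≤ K ^ 3 + 2000 * K ^ 2 := by gcongr <;> omega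
      omega

/-- The sharp upper bound for large graphs. -/
lemma exists_card_pathTuples_le : ∃ n₁ : ℕ, ∀ (V : Type) [Fintype V],
    n₁ ≤ Fintype.card V → ∀ G : SimpleGraph V, NoPathSeven G →
      #(pathTuples G) ≤ 4 * maxProd (Fintype.card V) := by
  obtain ⟨M, hM⟩ := exists_card_pathTuples_le_add_const
  refine ⟨12000 + M, fun V _ hV G hG => ?_⟩
  by_cases hB : HasBroom G
  · obtain ⟨a, b, W, _, G', ha, hb, hc, hG', hle⟩ := hB.exists_reduction hG
    have h1 := hM (Fintype.card W) W rfl G' hG'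
    rcases Nat.eq_zero_or_pos (Fintype.card W) with h0 | h0
    · rw [card_eq_zero_of_isEmpty h0] at hle
      have := le_maxProd (n := Fintype.card V) (a := a) (b := b) (by omega)
      omega
    -- Peeling gains `2 n - 24` ordered paths, which is at least `M` as `n ≥ 12000 + M`.
    · have := maxProd_superadditive ha hb h0
      rw [hc] at this
      omega
  · have h1 := card_pathTuples_le_of_not_hasBroom hG hB
    have := cube_add_le_maxProd (n := Fintype.card V) (by omega)
    omega

end UpperBound

/-! ### The graphs `S^{(3)}_{a,b}` and the theorem -/

section Extremal

lemma isTwoSets_cliqueTwoSets (a b : ℕ) : IsTwoSets (cliqueTwoSets 3 a b) (Sum.inl 1) (Sum.inl 2)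
    (Sum.inl 0) (univ.map (Function.Embedding.inl.trans Function.Embedding.inr))
    (univ.map (Function.Embedding.inr.trans Function.Embedding.inr)) := by
  constructor
  · rintro (i | i | i) hi (j | j | j) h <;> simp_all [cliqueTwoSets]
    fin_cases j <;> simp_all
  · rintro (i | i | i) hi (j | j | j) h <;> simp_all [cliqueTwoSets]
  · rintro (j | j | j) h <;> simp_all [cliqueTwoSets]
    fin_cases j <;> simp_all
  · rintro (j | j | j) h <;> simp_all [cliqueTwoSets]
    fin_cases j <;> simp_all
  · rintro (j | j | j) h <;> simp_all [cliqueTwoSets]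
    fin_cases j <;> simp_all
  all_goals try simp
  simp [disjoint_left]

lemma isPathSix_cliqueTwoSets {a b : ℕ} {x₁ x₂ x₃ x₄ x₅ x₆ : Fin 3 ⊕ (Fin a ⊕ Fin b)}
    (h : IsTwoSetsPath (Sum.inl 1) (Sum.inl 2) (Sum.inl 0)
      (univ.map (Function.Embedding.inl.trans Function.Embedding.inr))
      (univ.map (Function.Embedding.inr.trans Function.Embedding.inr)) x₁ x₂ x₃ x₄ x₅ x₆) :
    IsPathSix (cliqueTwoSets 3 a b) x₁ x₂ x₃ x₄ x₅ x₆ := by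
  obtain ⟨h1, h3, hne, rfl, h6, h⟩ := h
  simp only [mem_map, mem_univ, true_and] at h1 h3 h6
  obtain ⟨i, rfl⟩ := h1
  obtain ⟨j, rfl⟩ := h3
  obtain ⟨k, rfl⟩ := h6
  have hij : i ≠ j := by rintro rfl; exact hne rfl
  rcases h with ⟨rfl, rfl⟩ | ⟨rfl, rfl⟩ <;> simp [IsPathSix, cliqueTwoSets, hij]

lemma mem_vertices_cliqueTwoSets {a b : ℕ} (x : Fin 3 ⊕ (Fin a ⊕ Fin b)) :
    x ∈ univ.map (Function.Embedding.inl.trans Function.Embedding.inr) ∨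
    x ∈ univ.map (Function.Embedding.inr.trans Function.Embedding.inr) ∨
    x = Sum.inl 1 ∨ x = Sum.inl 2 ∨ x = Sum.inl 0 := by
  rcases x with x | x | x
  · fin_cases x <;> simp
  · simp
  · simp

lemma card_pathTuples_cliqueTwoSets (a b : ℕ) :
    #(pathTuples (cliqueTwoSets 3 a b)) = 4 * (a * (a - 1) * b) := by
  have h := isTwoSets_cliqueTwoSets a b
  have := card_twoSetsTuples h.ne_uw h.disj (v := Sum.inl 0)
  rw [card_map, card_map, card_univ, card_univ, Fintype.card_fin, Fintype.card_fin] at this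
  rw [← this]
  congr 1
  ext ⟨x₁, x₂, x₃, x₄, x₅, x₆⟩
  rw [mem_pathTuples, mem_twoSetsTuples]
  constructor
  · intro hp
    exact h.path_cases hp (mem_vertices_cliqueTwoSets x₁)
  · rintro (hp | hp)
    · exact isPathSix_cliqueTwoSets hp
    · exact (isPathSix_cliqueTwoSets hp).reverse

/-- The first six vertices make `x₂` one of `u`, `w`, `v`; the last six, which start at `x₂`, put it
in `A ∪ B`. -/
lemma noPathSeven_cliqueTwoSets (a b : ℕ) : NoPathSeven (cliqueTwoSets 3 a b) := by
  intro x₁ x₂ x₃ x₄ x₅ x₆ x₇ h1 h2 h3 h4 h5 h6 hn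
  have h := isTwoSets_cliqueTwoSets a b
  have hp : IsPathSix (cliqueTwoSets 3 a b) x₁ x₂ x₃ x₄ x₅ x₆ :=
    ⟨h1, h2, h3, h4, h5, hn.sublist (List.sublist_append_left _ [x₇])⟩
  have hq : IsPathSix (cliqueTwoSets 3 a b) x₂ x₃ x₄ x₅ x₆ x₇ := ⟨h2, h3, h4, h5, h6, hn.tail⟩
  have c1 := h.path_cases hp (mem_vertices_cliqueTwoSets _)
  have c2 := h.path_cases hq (mem_vertices_cliqueTwoSets _)
  have := h.u_notMem_A; have := h.w_notMem_A; have := h.v_notMem_A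
  have := h.u_notMem_B; have := h.w_notMem_B; have := h.v_notMem_B
  unfold IsTwoSetsPath at c1 c2
  have m : x₂ = Sum.inl 1 ∨ x₂ = Sum.inl 2 ∨ x₂ = Sum.inl 0 := by tauto
  rcases m with rfl | rfl | rfl <;> tauto

lemma copyCount_of_iso_cliqueTwoSets {V : Type*} [Fintype V] {G : SimpleGraph V} {a b : ℕ}
    (e : G ≃g cliqueTwoSets 3 a b) : G.copyCount (pathEdges 5) = 2 * (a * (a - 1) * b) := by
  have h1 := two_mul_copyCount_eq_card_pathTuples G
  rw [card_pathTuples_congr e, card_pathTuples_cliqueTwoSets] at h1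
  omega

lemma card_of_iso_cliqueTwoSets {n a b : ℕ} {G : SimpleGraph (Fin n)}
    (e : G ≃g cliqueTwoSets 3 a b) : a + b + 3 = n := by
  have := Fintype.card_congr e.toEquiv
  simp only [Fintype.card_fin, Fintype.card_sum] at this
  omega

lemma exists_iso_cliqueTwoSets {n a b : ℕ} (h : a + b + 3 = n) :
    ∃ G : SimpleGraph (Fin n), Nonempty (G ≃g cliqueTwoSets 3 a b) := by
  have hc : Fintype.card (Fin 3 ⊕ (Fin a ⊕ Fin b)) = n := by
    simp only [Fintype.card_fin, Fintype.card_sum]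
    omega
  exact ⟨(cliqueTwoSets 3 a b).overFin hc, ⟨((cliqueTwoSets 3 a b).overFinIso hc).symm⟩⟩

lemma copyCount_le_of_inFamilyS {n : ℕ} {G : SimpleGraph (Fin n)} (h : InFamilyS 3 G) :
    G.copyCount (pathEdges 5) ≤ 2 * maxProd n := by
  obtain ⟨a, b, -, -, ⟨e⟩⟩ := h
  rw [copyCount_of_iso_cliqueTwoSets e]
  exact Nat.mul_le_mul_left 2 (le_maxProd (card_of_iso_cliqueTwoSets e))

lemma free_of_inFamilyS {n : ℕ} {G : SimpleGraph (Fin n)} (h : InFamilyS 3 G) :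
    (pathEdges 6).Free G := by
  obtain ⟨a, b, -, -, ⟨e⟩⟩ := h
  exact (SimpleGraph.free_congr_right e).mpr
    (noPathSeven_iff_free.mp (noPathSeven_cliqueTwoSets a b))

lemma exists_inFamilyS_copyCount_eq {n : ℕ} (hn : 6 ≤ n) : ∃ G : SimpleGraph (Fin n),
    InFamilyS 3 G ∧ G.copyCount (pathEdges 5) = 2 * maxProd n := by
  obtain ⟨a, b, hab, ha, hb, h⟩ := exists_maxProd_eq hn
  obtain ⟨G, ⟨e⟩⟩ := exists_iso_cliqueTwoSets hab
  exact ⟨G, ⟨a, b, by omega, by omega, ⟨e⟩⟩, by rw [copyCount_of_iso_cliqueTwoSets e, h]⟩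

end Extremal

theorem theorem5p2 :
    ∃ (n₁ : ℕ) (C : ℝ), ∀ n : ℕ, n₁ ≤ n →
      (∃ H : SimpleGraph (Fin n), IsGraphH 6 H) ∧
      (∀ H : SimpleGraph (Fin n), IsGraphH 6 H →
        (pathEdges 6).Free H ∧
          exCopies n (pathEdges 5) (pathEdges 6) = H.copyCount (pathEdges 5)) ∧
      |(exCopies n (pathEdges 5) (pathEdges 6) : ℝ) - 8 * (n : ℝ) ^ 3 / 27| ≤ C * (n : ℝ) ^ 2 := by
  obtain ⟨n₁, hn₁⟩ := exists_card_pathTuples_le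
  -- From `n = 6` on `maxProd n` is attained with `a, b ≥ 1`; and `15 ≥ 2 · 200 / 27`.
  refine ⟨n₁ + 6, 15, fun n hn => ?_⟩
  obtain ⟨H₀, hH₀, hcount⟩ := exists_inFamilyS_copyCount_eq (n := n) (by omega)
  have hex : exCopies n (pathEdges 5) (pathEdges 6) = 2 * maxProd n := by
    classical
    apply le_antisymm
    · refine Finset.sup_le fun G hG => ?_
      have h1 := hn₁ (Fin n) (by simp; omega) G
        (noPathSeven_iff_free.mpr (by simpa using hG))
      rw [← two_mul_copyCount_eq_card_pathTuples, Fintype.card_fin] at h1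
      omega
    · rw [← hcount]
      exact Finset.le_sup (f := fun G : SimpleGraph (Fin n) => G.copyCount (pathEdges 5))
        (by simpa using free_of_inFamilyS hH₀)
  refine ⟨⟨H₀, hH₀, fun G' hG' => ?_⟩, fun H hH => ⟨free_of_inFamilyS hH.1, ?_⟩, ?_⟩
  · exact (copyCount_le_of_inFamilyS hG').trans hcount.ge
  · rw [hex]
    exact (hcount.symm.le.trans (hH.2 H₀ hH₀)).antisymm (copyCount_le_of_inFamilyS hH.1)
  · rw [hex]
    have h1 : (27 * maxProd n : ℝ) ≤ 4 * n ^ 3 := by exact_mod_cast maxProd_le n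
    have h2 : (4 * n ^ 3 : ℝ) ≤ 27 * maxProd n + 200 * n ^ 2 := by
      exact_mod_cast le_maxProd_add n
    have h3 : (0 : ℝ) ≤ n ^ 2 := by positivity
    push_cast
    rw [abs_le]
    constructor <;> linarith
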